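/- Let $\mathbb{K}$ be a ring (associative, with unity, not necessarily commutative). An element of $\mathbb K$ is invertible if it has a two-sided inverse; the inverse is denoted $x^{-1}$. For a finite poset $P$, let $\widehat P=P\sqcup\{0,1\}$ be the poset obtained by adjoining a new least element $0$ and a new greatest element $1$, and let $\lessdot$ denote its covering relation. A $\mathbb K$-labeling of $P$ is a map $f:\widehat P\to\mathbb K$. For $v\in P$, the toggle $T_v$ is the partial map from $\mathbb K^{\widehat P}$ to itself with $(T_vf)(w)=f(w)$ for $w\ne v$ and $$(T_vf)(v)=\Big(\sum_{u\in\widehat P,\ u\lessdot v}f(u)\Big)\cdot f(v)^{-1}\cdot\Big(\sum_{u\in\widehat P,\ v\lessdot u}f(u)^{-1}\Big)^{-1},$$ where $T_vf$ is undefined if any of the inverses on the right-hand side does not exist. Birational rowmotion is the partial map $R=T_{v_1}\circ T_{v_2}\circ\cdots\circ T_{v_m}$, where $(v_1,\dots,v_m)$ is a linear extension of $P$ (a list containing each element of $P$ exactly once, such that $v_i<v_j$ implies $i<j$); it does not depend on the choice of the linear extension. A composition of partial maps is undefined wherever one of its steps is, $R^k$ is the $k$-fold composition of $R$ with itself, and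 $R^0=\mathrm{id}$. **Theorem (Reciprocity theorem for the $p\times q$-rectangle).** Let $p,q$ be positive integers, and let $P=[p]\times[q]=\{1,\dots,p\}\times\{1,\dots,q\}$ with the entrywise order. Let $\ell\in\mathbb N=\{0,1,2,\dots\}$, and let $f\in\mathbb K^{\widehat P}$ be a $\mathbb K$-labeling such that $R^{\ell}f$ is defined. Set $a=f(0)$ and $b=f(1)$. Let $(i,j)\in P$ satisfy $\ell-i-j+1\ge 0$. Then $R^{\ell-i-j+1}f$ is defined, its label at $(p+1-i,\,q+1-j)$ is invertible, and $$(R^{\ell}f)(i,j)=a\cdot\big((R^{\ell-i-j+1}f)(p+1-i,\,q+1-j)\big)^{-1}\cdot b.$$ -/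

import Mathlib

/-- The extended poset of `P`: a new least element `0` (written `⊥`) and a new greatest
element `1` (written `⊤`) are adjoined to `P`. -/
abbrev ExtPoset (P : Type*) := WithBot (WithTop P)

namespace ExtPoset

/-- The inclusion of `P` into the extended poset. -/
def ofElem {P : Type*} (v : P) : ExtPoset P := ((v : WithTop P) : WithBot (WithTop P))

theorem ofElem_injective {P : Type*} : Function.Injective (ofElem : P → ExtPoset P) :=
  fun _ _ h => WithTop.coe_injective (WithBot.coe_injective h)

theorem ofElem_lt_ofElem {P : Type*} [PartialOrder P] {v w : P} :
    ofElem v < ofElem w ↔ v < w := by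
  simp [ofElem]

end ExtPoset

/-- A `K`-labeling of `P`: a map from the extended poset to `K`. -/
abbrev Labeling (P K : Type*) := ExtPoset P → K

/-- A partial map from `X` to `Y`; the value `none` stands for "undefined". -/
abbrev PartialMap (X Y : Type*) := X → Option Y

namespace PartialMap

/-- Composition `f ∘ g` of partial maps: undefined wherever `g` is. -/
def comp {X Y Z : Type*} (f : PartialMap Y Z) (g : PartialMap X Y) : PartialMap X Z :=
  fun x => (g x).bind f

/-- The `k`-th power `f ∘ f ∘ ⋯ ∘ f` of a partial map from `X` to `X`; the zeroth power is the
(everywhere defined) identity. -/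
def pow {X : Type*} (f : PartialMap X X) : ℕ → PartialMap X X
  | 0 => some
  | k + 1 => comp f (pow f k)

theorem comp_assoc {X Y Z W : Type*} (f : PartialMap Z W) (g : PartialMap Y Z)
    (h : PartialMap X Y) : comp (comp f g) h = comp f (comp g h) := by
  funext x
  simp only [comp]
  cases h x <;> rfl

end PartialMap

section Rowmotion

variable {P K : Type*} [PartialOrder P] [Fintype P] [Ring K]

open scoped Classical in
/-- The sum of the labels of the elements of the extended poset that are covered by `v`. -/
noncomputable def lowerSum (f : Labeling P K) (v : P) : K :=
  ∑ u : ExtPoset P with u ⋖ ExtPoset.ofElem v, f u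

open scoped Classical in
/-- The sum of the inverses of the labels of the elements of the extended poset that cover `v`
(meaningful if all these labels are invertible). -/
noncomputable def upperInvSum (f : Labeling P K) (v : P) : K :=
  ∑ u : ExtPoset P with ExtPoset.ofElem v ⋖ u, Ring.inverse (f u)

/-- All inverses that occur in the definition of the toggle at `v` exist. -/
def Toggleable (v : P) (f : Labeling P K) : Prop :=
  IsUnit (f (ExtPoset.ofElem v)) ∧
    (∀ u : ExtPoset P, ExtPoset.ofElem v ⋖ u → IsUnit (f u)) ∧
    IsUnit (upperInvSum f v)

open scoped Classical in
/-- The `v`-toggle: it replaces the label at `v` by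
`(∑_{u ⋖ v} f u) * (f v)⁻¹ * (∑_{v ⋖ u} (f u)⁻¹)⁻¹`, keeps all other labels, and is undefined
if one of these inverses does not exist. -/
noncomputable def toggle (v : P) : PartialMap (Labeling P K) (Labeling P K) := fun f =>
  if Toggleable v f then
    some (Function.update f (ExtPoset.ofElem v)
      (lowerSum f v * Ring.inverse (f (ExtPoset.ofElem v)) * Ring.inverse (upperInvSum f v)))
  else none

/-- The partial map `T_{v₁} ∘ T_{v₂} ∘ ⋯ ∘ T_{vₘ}` for a list `(v₁, …, vₘ)`; in particular the
toggle at the last entry is applied first. -/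
noncomputable def toggleList : List P → PartialMap (Labeling P K) (Labeling P K)
  | [] => some
  | v :: L => PartialMap.comp (toggle v) (toggleList L)

/-- A linear extension of `P`: a list that contains each element of `P` exactly once, and in which
no entry is followed by a smaller one. -/
structure IsLinearExtension (L : List P) : Prop where
  nodup : L.Nodup
  mem : ∀ v : P, v ∈ L
  ordered : L.Pairwise fun u v => ¬ v < u

variable (P) in
theorem exists_isLinearExtension : ∃ L : List P, IsLinearExtension L := by
  classical
  have _ : Fintype (LinearExtension P) := inferInstanceAs (Fintype P)
  let S : List (LinearExtension P) := (Finset.univ : Finset (LinearExtension P)).sort (· ≤ ·)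
  have h1 : S.Nodup := Finset.sort_nodup _ _
  have h2 : ∀ v : LinearExtension P, v ∈ S := fun v => by simp [S]
  have h3 : S.Pairwise (· ≤ ·) := Finset.pairwise_sort _ _
  refine ⟨S, h1, h2, ?_⟩
  refine h3.imp fun {u v} huv hvu => ?_
  have h4 : (toLinearExtension (α := P) v) ≤ toLinearExtension (α := P) u :=
    toLinearExtension.monotone hvu.le
  exact hvu.ne (le_antisymm (α := LinearExtension P) h4 huv)

variable (P K) in
/-- Birational rowmotion of `P`: the composition `T_{v₁} ∘ T_{v₂} ∘ ⋯ ∘ T_{vₘ}` along a linear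
extension `(v₁, …, vₘ)` of `P`. By `rowmotion_eq_toggleList` it does not depend on the choice of
the linear extension. -/
noncomputable def rowmotion : PartialMap (Labeling P K) (Labeling P K) :=
  toggleList (exists_isLinearExtension P).choose

theorem upperInvSum_congr {f g : Labeling P K} {v : P}
    (h : ∀ u, ExtPoset.ofElem v ⋖ u → f u = g u) : upperInvSum f v = upperInvSum g v := by
  classical
  refine Finset.sum_congr rfl fun u hu => ?_
  rw [h u (Finset.mem_filter.1 hu).2]

theorem lowerSum_congr {f g : Labeling P K} {v : P}
    (h : ∀ u, u ⋖ ExtPoset.ofElem v → f u = g u) : lowerSum f v = lowerSum g v := by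
  classical
  exact Finset.sum_congr rfl fun u hu => h u (Finset.mem_filter.1 hu).2

theorem toggle_comm {v w : P} (hvw : ¬ v < w) (hwv : ¬ w < v) :
    (PartialMap.comp (toggle v) (toggle w) : PartialMap (Labeling P K) (Labeling P K)) =
      PartialMap.comp (toggle w) (toggle v) := by
  classical
  rcases eq_or_ne v w with rfl | hne
  · rfl
  have key : ∀ {v w : P}, ¬ v < w → ¬ w < v → v ≠ w → ∀ (f : Labeling P K) (x : K),
      (∀ u, ExtPoset.ofElem v ⋖ u → Function.update f (ExtPoset.ofElem w) x u = f u) ∧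
      (∀ u, u ⋖ ExtPoset.ofElem v → Function.update f (ExtPoset.ofElem w) x u = f u) ∧
      Function.update f (ExtPoset.ofElem w) x (ExtPoset.ofElem v) = f (ExtPoset.ofElem v) := by
    intro v w h1 h2 h3 f x
    refine ⟨fun u hu => ?_, fun u hu => ?_, ?_⟩
    · refine Function.update_of_ne ?_ _ _
      rintro rfl
      exact h1 (ExtPoset.ofElem_lt_ofElem.1 hu.lt)
    · refine Function.update_of_ne ?_ _ _
      rintro rfl
      exact h2 (ExtPoset.ofElem_lt_ofElem.1 hu.lt)
    · exact Function.update_of_ne (fun h => h3 (ExtPoset.ofElem_injective h)) _ _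
  have key2 : ∀ {v w : P}, ¬ v < w → ¬ w < v → v ≠ w → ∀ (f : Labeling P K) (x : K),
      (Toggleable v (Function.update f (ExtPoset.ofElem w) x) ↔ Toggleable v f) ∧
      lowerSum (Function.update f (ExtPoset.ofElem w) x) v = lowerSum f v ∧
      upperInvSum (Function.update f (ExtPoset.ofElem w) x) v = upperInvSum f v ∧
      Function.update f (ExtPoset.ofElem w) x (ExtPoset.ofElem v) = f (ExtPoset.ofElem v) := by
    intro v w h1 h2 h3 f x
    obtain ⟨a, b, c⟩ := key h1 h2 h3 f x
    refine ⟨?_, lowerSum_congr b, upperInvSum_congr a, c⟩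
    unfold Toggleable
    rw [c, upperInvSum_congr a]
    refine and_congr Iff.rfl (and_congr ?_ Iff.rfl)
    exact forall₂_congr fun u hu => by rw [a u hu]
  funext f
  simp only [PartialMap.comp, toggle]
  by_cases hv : Toggleable v f <;> by_cases hw : Toggleable w f
  · simp only [hv, hw, if_true, Option.bind_some, toggle, key2 hvw hwv hne f,
      key2 hwv hvw hne.symm f]
    rw [Function.update_comm (fun h => hne (ExtPoset.ofElem_injective h.symm))]
  · simp [toggle, hv, hw, key2 hwv hvw hne.symm f]
  · simp [toggle, hv, hw, key2 hvw hwv hne f]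
  · simp [hv, hw]

theorem toggleList_move {v : P} (A B : List P) (h : ∀ a ∈ A, ¬ v < a ∧ ¬ a < v) :
    (toggleList (A ++ v :: B) : PartialMap (Labeling P K) (Labeling P K)) =
      toggleList (v :: (A ++ B)) := by
  induction A with
  | nil => rfl
  | cons a A ih =>
    have ha := h a (by simp)
    simp only [List.cons_append, toggleList]
    rw [ih fun x hx => h x (by simp [hx])]
    simp only [toggleList]
    rw [← PartialMap.comp_assoc, ← PartialMap.comp_assoc, toggle_comm ha.2 ha.1]

theorem toggleList_eq_of_perm : ∀ {L M : List P}, L.Perm M →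
    (L.Pairwise fun u v => ¬ v < u) → (M.Pairwise fun u v => ¬ v < u) →
    (toggleList L : PartialMap (Labeling P K) (Labeling P K)) = toggleList M := by
  intro L
  induction L with
  | nil =>
    intro M h _ _
    rw [h.nil_eq]
  | cons v L ih =>
    intro M h hL hM
    obtain ⟨A, B, rfl⟩ := List.append_of_mem (h.subset (by simp : v ∈ v :: L))
    have hp : L.Perm (A ++ B) := (h.trans List.perm_middle).cons_inv
    rw [List.pairwise_cons] at hL
    rw [List.pairwise_append] at hM
    rw [toggleList_move A B]
    · simp only [toggleList]
      rw [ih hp hL.2]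
      rw [List.pairwise_append]
      exact ⟨hM.1, (List.pairwise_cons.1 hM.2.1).2,
        fun a ha b hb => hM.2.2 a ha b (by simp [hb])⟩
    · exact fun a ha => ⟨hM.2.2 a ha v (by simp), hL.1 a (hp.symm.subset (by simp [ha]))⟩

/-- Birational rowmotion may be computed along any linear extension. -/
theorem rowmotion_eq_toggleList {L : List P} (hL : IsLinearExtension L) :
    rowmotion P K = toggleList L := by
  have h := (exists_isLinearExtension P).choose_spec
  refine toggleList_eq_of_perm ?_ h.ordered hL.ordered
  exact (List.perm_ext_iff_of_nodup h.nodup hL.nodup).2 fun v => by simp [h.mem, hL.mem]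

end Rowmotion

/-- The chain `[p] = {1, 2, …, p}` with its usual order. -/
abbrev Chain (p : ℕ) := {i : ℕ // i ∈ Set.Icc 1 p}

/-- The `p × q`-rectangle `[p] × [q]` with the entrywise order. -/
abbrev Rect (p q : ℕ) := Chain p × Chain q

namespace Chain

/-- The element `p + 1 - i` of `[p]`. -/
def flip {p : ℕ} (i : Chain p) : Chain p :=
  ⟨p + 1 - i, by have h := i.2; simp only [Set.mem_Icc] at h ⊢; omega⟩

end Chain

/-! Write `x t` for the labels at time `t` and suppose they are all invertible. One step of
rowmotion says that a single weight has two descriptions: `x t v` times the inverse of its lower sum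
at time `t`, and the inverse upper sum at time `t + 1` times `(x (t + 1) v)⁻¹`. Unfolding the first
description downwards gives `x t v` as the weighted sum over saturated chains from `v` to the
minimum, times `a`. Unfolding the second upwards gives `(x (t + 1) v)⁻¹` as `b⁻¹` times the sum over
chains from the maximum to `v` (`eq_pathSum_mul`, `eq_mul_pathSum`).

The heart is `Rect.conversion`: a path sum from the edge with first coordinate `p` to the edge with
first coordinate `1` is unchanged when time and both second coordinates drop by one. Iterating this
from `(p, q) → (1, j)` down to `(p, q + 1 - j) → (1, 1)` proves reciprocity for `i = 1`. Induction
on `i` does the rest: comparing the transition equations at `(i - 1, j)` and at its antipode leaves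
`(i, j)` as the only unknown.

Invertibility of the labels follows from rowmotion being defined, except that `a` may fail to be a
unit when `ℓ = 1`; there `a` is only a left factor and can be split off. -/

/-! ### Covers and sums in the extended poset -/

namespace ExtPoset

variable {P : Type*} [PartialOrder P]

theorem ofElem_covBy_ofElem {v w : P} :
    ofElem v ⋖ ofElem w ↔ v ⋖ w := by
  simp [ofElem]

theorem bot_covBy_ofElem {v : P} : (⊥ : ExtPoset P) ⋖ ofElem v ↔ IsMin v := by
  rw [ofElem, WithBot.bot_covBy_coe]
  refine ⟨fun h w hw => WithTop.coe_le_coe.1 (h (WithTop.coe_le_coe.2 hw)), fun h w hw => ?_⟩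
  obtain ⟨u, rfl⟩ := WithTop.ne_top_iff_exists.1 (hw.trans_lt (WithTop.coe_lt_top v)).ne
  exact WithTop.coe_le_coe.2 (h (WithTop.coe_le_coe.1 hw))

theorem ofElem_covBy_top {v : P} : ofElem v ⋖ (⊤ : ExtPoset P) ↔ IsMax v := by
  rw [ofElem, ← WithBot.coe_top, WithBot.coe_covBy_coe, WithTop.coe_covBy_top]

theorem sum_eq {P M : Type*} [Fintype P] [AddCommMonoid M] (f : ExtPoset P → M) :
    ∑ u, f u = f ⊥ + (f ⊤ + ∑ v, f (ofElem v)) := by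
  have h1 : ∑ u, f u = f ⊥ + ∑ u : WithTop P, f u := Fintype.sum_option f
  have h2 : ∑ u : WithTop P, f u = f ⊤ + ∑ v : P, f (ofElem v) :=
    Fintype.sum_option fun u : WithTop P => f u
  rw [h1, h2]

end ExtPoset

/-! ### Rowmotion as a system of equations between consecutive labelings -/

section Transition

variable {P K : Type*} [PartialOrder P] [Fintype P] [Ring K]

open scoped Classical in
/-- The sum of the values of `f` at the elements covered by `v`, with `a` added if `v` is
minimal. -/
noncomputable def downSum (a : K) (f : P → K) (v : P) : K :=
  (∑ u with u ⋖ v, f u) + if IsMin v then a else 0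

open scoped Classical in
/-- The sum of the values of `f` at the elements covering `v`, with `c` added if `v` is
maximal. -/
noncomputable def upSum (c : K) (f : P → K) (v : P) : K :=
  (∑ u with v ⋖ u, f u) + if IsMax v then c else 0

theorem lowerSum_eq_downSum (f : Labeling P K) (v : P) :
    lowerSum f v = downSum (f ⊥) (fun u => f (ExtPoset.ofElem u)) v := by
  classical
  rw [lowerSum, downSum, Finset.sum_filter, ExtPoset.sum_eq, Finset.sum_filter]
  simp [-bot_covBy_iff, -covBy_top_iff, ExtPoset.ofElem_covBy_ofElem, ExtPoset.bot_covBy_ofElem, add_comm]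

theorem upperInvSum_eq_upSum (f : Labeling P K) (v : P) :
    upperInvSum f v =
      upSum (Ring.inverse (f ⊤)) (fun u => Ring.inverse (f (ExtPoset.ofElem u))) v := by
  classical
  rw [upperInvSum, upSum, Finset.sum_filter, ExtPoset.sum_eq, Finset.sum_filter]
  simp [-bot_covBy_iff, -covBy_top_iff, ExtPoset.ofElem_covBy_ofElem, ExtPoset.ofElem_covBy_top, add_comm]

open scoped Classical in
theorem toggle_eq_some_iff {v : P} {f g : Labeling P K} :
    toggle v f = some g ↔ Toggleable v f ∧ Function.update f (ExtPoset.ofElem v)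
      (lowerSum f v * Ring.inverse (f (ExtPoset.ofElem v)) * Ring.inverse (upperInvSum f v)) =
        g := by
  unfold toggle
  split_ifs with h <;> simp [h]

/-- The relation between a labeling and its image under rowmotion at the element `v`. -/
structure TransitionAt (f g : Labeling P K) (v : P) : Prop where
  isUnit_self : IsUnit (f (ExtPoset.ofElem v))
  isUnit_upper : ∀ u, ExtPoset.ofElem v ⋖ u → IsUnit (g u)
  isUnit_upperInvSum : IsUnit (upperInvSum g v)
  eq : g (ExtPoset.ofElem v) = lowerSum f v * Ring.inverse (f (ExtPoset.ofElem v)) *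
    Ring.inverse (upperInvSum g v)

/-- Toggles act from the end of the list, so from larger elements to smaller ones. When `v` is
toggled, its upper covers in the list already carry their final labels, while `v` and its lower
covers still carry the labels of `f`. -/
theorem transitionAt_of_toggleList {L : List P} {f g : Labeling P K} (hn : L.Nodup)
    (ho : L.Pairwise fun u v => ¬ v < u) (h : toggleList L f = some g) :
    (∀ u, (∀ v ∈ L, u ≠ ExtPoset.ofElem v) → g u = f u) ∧ ∀ v ∈ L, TransitionAt f g v := by
  classical
  induction L generalizing g with
  | nil =>
    simp only [toggleList, Option.some.injEq] at h
    simp [h]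
  | cons v B ih =>
    simp only [toggleList, PartialMap.comp, Option.bind_eq_some_iff] at h
    obtain ⟨h', hB, hv⟩ := h
    rw [List.nodup_cons] at hn
    rw [List.pairwise_cons] at ho
    obtain ⟨ih1, ih2⟩ := ih hn.2 ho.2 hB
    obtain ⟨⟨t1, t2, t3⟩, hg⟩ := toggle_eq_some_iff.1 hv
    have hgne : ∀ u, u ≠ ExtPoset.ofElem v → g u = h' u := fun u hu => by
      rw [← hg, Function.update_of_ne hu]
    have hself : h' (ExtPoset.ofElem v) = f (ExtPoset.ofElem v) :=
      ih1 _ fun w hw e => hn.1 (ExtPoset.ofElem_injective e ▸ hw)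
    refine ⟨fun u hu => ?_, fun w hw => ?_⟩
    · rw [hgne u (hu v (by simp)), ih1 u fun w hw => hu w (by simp [hw])]
    · rcases List.mem_cons.1 hw with rfl | hw
      · have hup : ∀ u, ExtPoset.ofElem w ⋖ u → g u = h' u := fun u hu => hgne u hu.lt.ne'
        refine ⟨hself ▸ t1, fun u hu => hup u hu ▸ t2 u hu, ?_, ?_⟩
        · rwa [upperInvSum_congr hup]
        · rw [upperInvSum_congr hup, ← hself, ← hg, Function.update_self]
          congr 2
          refine lowerSum_congr fun u hu => ih1 u ?_
          rintro z hz rfl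
          exact ho.1 z hz (ExtPoset.ofElem_lt_ofElem.1 hu.lt)
      · have hne : ExtPoset.ofElem w ≠ ExtPoset.ofElem v := fun e =>
          hn.1 (ExtPoset.ofElem_injective e ▸ hw)
        have hup : ∀ u, ExtPoset.ofElem w ⋖ u → g u = h' u := by
          refine fun u hu => hgne u ?_
          rintro rfl
          exact ho.1 w hw (ExtPoset.ofElem_lt_ofElem.1 hu.lt)
        obtain ⟨s1, s2, s3, s4⟩ := ih2 w hw
        refine ⟨s1, fun u hu => hup u hu ▸ s2 u hu, ?_, ?_⟩
        · rwa [upperInvSum_congr hup]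
        · rw [upperInvSum_congr hup, hgne _ hne, s4]

theorem transitionAt_of_rowmotion {f g : Labeling P K} (h : rowmotion P K f = some g) :
    g ⊥ = f ⊥ ∧ g ⊤ = f ⊤ ∧ ∀ v, TransitionAt f g v := by
  have hL := (exists_isLinearExtension P).choose_spec
  obtain ⟨h1, h2⟩ := transitionAt_of_toggleList hL.nodup hL.ordered h
  refine ⟨h1 _ fun v _ e => ?_, h1 _ fun v _ e => ?_, fun v => h2 v (hL.mem v)⟩
  · exact WithBot.bot_ne_coe e
  · exact WithTop.top_ne_coe (WithBot.coe_injective e)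

/-- The orbit of a labeling under a power of a partial map that is defined. -/
theorem PartialMap.exists_orbit {X : Type*} {r : PartialMap X X} {n : ℕ} {x y : X}
    (h : PartialMap.pow r n x = some y) :
    ∃ F : ℕ → X, F 0 = x ∧ F n = y ∧ (∀ t ≤ n, PartialMap.pow r t x = some (F t)) ∧
      ∀ t < n, r (F t) = some (F (t + 1)) := by
  have key : ∀ t ≤ n, (PartialMap.pow r t x).isSome := by
    intro t ht
    induction n generalizing y with
    | zero => simp_all
    | succ n ih =>
      rcases ht.eq_or_lt with rfl | ht
      · simp [h]
      · simp only [PartialMap.pow, PartialMap.comp, Option.bind_eq_some_iff] at h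
        obtain ⟨z, hz, -⟩ := h
        exact ih hz (by omega)
  have hF : ∀ t ≤ n, PartialMap.pow r t x = some ((PartialMap.pow r t x).getD x) := by
    intro t ht
    obtain ⟨z, hz⟩ := Option.isSome_iff_exists.1 (key t ht)
    simp [hz]
  refine ⟨fun t => (PartialMap.pow r t x).getD x, by simp [PartialMap.pow], by simp [h], hF,
    fun t ht => ?_⟩
  have h2 := hF (t + 1) ht
  conv_lhs at h2 => simp only [PartialMap.pow, PartialMap.comp]
  rwa [hF t ht.le, Option.bind_some] at h2

end Transition

/-! ### Weighted sums over saturated chains -/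

section PathSums

variable {P K : Type*} [PartialOrder P] [Fintype P] [Ring K]

open scoped Classical in
variable (P K) in
/-- The matrix of the covering relation: the entry at `(x, y)` is `1` if `x` covers `y`. -/
noncomputable def coverMatrix : Matrix P P K := Matrix.of fun x y => if y ⋖ x then 1 else 0

open scoped Classical in
/-- The transfer matrix of a weight: its powers enumerate the weighted descending paths. -/
noncomputable def stepMatrix (w : P → K) : Matrix P P K := coverMatrix P K * Matrix.diagonal w

open scoped Classical in
/-- The sum over all saturated descending chains from `x` to `y` of the product of the weights of
their elements, as a matrix in `x` and `y`. -/
noncomputable def pathSum (w : P → K) : Matrix P P K :=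
  Matrix.diagonal w * ∑ n ∈ Finset.range (Fintype.card P + 1), stepMatrix w ^ n

open scoped Classical in
-- The number of elements strictly below drops at every step of a descending path, so no path has
-- more than `Fintype.card P` steps.
theorem stepMatrix_pow_eq_zero (w : P → K) : stepMatrix w ^ (Fintype.card P + 1) = 0 := by
  let r : P → ℕ := fun x => (Finset.univ.filter (· < x)).card
  have hr : ∀ {x y : P}, y < x → r y < r x := fun {x y} h => by
    refine Finset.card_lt_card ⟨fun z hz => ?_, fun hs => ?_⟩
    · simp only [Finset.mem_filter_univ] at hz ⊢
      exact hz.trans h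
    · have := hs (show y ∈ Finset.univ.filter (· < x) by simpa using h)
      simp at this
  have key : ∀ n x y, (stepMatrix w ^ n) x y ≠ 0 → r y + n ≤ r x := by
    intro n
    induction n with
    | zero =>
      intro x y h
      rw [pow_zero, Matrix.one_apply] at h
      have : x = y := by by_contra hne; simp [hne] at h
      simp [this]
    | succ n ih =>
      intro x y h
      rw [pow_succ, Matrix.mul_apply] at h
      obtain ⟨z, -, hz⟩ := Finset.exists_ne_zero_of_sum_ne_zero h
      have h1 := ih x z (left_ne_zero_of_mul hz)
      have h2 : y ⋖ z := by
        by_contra hn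
        exact right_ne_zero_of_mul hz (by simp [stepMatrix, coverMatrix, hn])
      have := hr h2.lt
      omega
  ext x y
  by_contra h
  have h1 := key _ x y h
  have h2 : r x ≤ Fintype.card P := Finset.card_le_univ _
  omega

open scoped Classical in
-- By nilpotency the finite geometric series inverts `1 - stepMatrix w`; this splits off the top
-- element of each chain.
theorem pathSum_eq_add_left (w : P → K) :
    pathSum w = Matrix.diagonal w + Matrix.diagonal w * coverMatrix P K * pathSum w := by
  have h := mul_neg_geom_sum (stepMatrix w) (Fintype.card P + 1)
  rw [stepMatrix_pow_eq_zero, sub_zero, sub_mul, one_mul, sub_eq_iff_eq_add] at h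
  conv_lhs => rw [pathSum, h, mul_add, mul_one]
  simp only [pathSum, stepMatrix, mul_assoc]

open scoped Classical in
theorem pathSum_eq_add_right (w : P → K) :
    pathSum w = Matrix.diagonal w + pathSum w * coverMatrix P K * Matrix.diagonal w := by
  have h := geom_sum_mul_neg (stepMatrix w) (Fintype.card P + 1)
  rw [stepMatrix_pow_eq_zero, sub_zero, mul_sub, mul_one, sub_eq_iff_eq_add] at h
  conv_lhs => rw [pathSum, h, mul_add, mul_one]
  simp only [pathSum, stepMatrix, mul_assoc]

open scoped Classical in
theorem pathSum_apply_left (w : P → K) (x y : P) :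
    pathSum w x y = w x * ((if x = y then 1 else 0) + ∑ z with z ⋖ x, pathSum w z y) := by
  conv_lhs => rw [pathSum_eq_add_left]
  rw [Matrix.add_apply, mul_assoc, Matrix.diagonal_mul, Matrix.mul_apply, mul_add,
    Finset.sum_filter]
  simp [coverMatrix, Matrix.diagonal_apply]

open scoped Classical in
theorem pathSum_apply_right (w : P → K) (x y : P) :
    pathSum w x y = ((if y = x then 1 else 0) + ∑ z with y ⋖ z, pathSum w x z) * w y := by
  conv_lhs => rw [pathSum_eq_add_right]
  rw [Matrix.add_apply, Matrix.mul_diagonal, Matrix.mul_apply, add_mul, Finset.sum_filter]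
  by_cases h : y = x
  · subst h; simp [coverMatrix]
  · simp [coverMatrix, h, Matrix.diagonal_apply_ne' _ h]

/-- A solution of a weighted recursion along lower covers is a path sum down to the minimum. -/
theorem eq_pathSum_mul {w f : P → K} {a : K} {m : P} (hm : ∀ x : P, IsMin x ↔ x = m)
    (h : ∀ x, w x * downSum a f x = f x) (x : P) : f x = pathSum w x m * a := by
  induction x using WellFoundedLT.induction with
  | ind x ih =>
  classical
  rw [← h x, pathSum_apply_left, downSum, mul_assoc, add_mul, add_comm, Finset.sum_mul,
    Finset.sum_congr rfl fun z hz => ih z (Finset.mem_filter.1 hz).2.lt]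
  simp [hm]

/-- A solution of a weighted recursion along upper covers is a path sum from the maximum. -/
theorem eq_mul_pathSum {w f : P → K} {c : K} {m : P} (hm : ∀ x : P, IsMax x ↔ x = m)
    (h : ∀ x, upSum c f x * w x = f x) (x : P) : f x = c * pathSum w m x := by
  induction x using WellFoundedGT.induction with
  | ind x ih =>
  classical
  rw [← h x, pathSum_apply_right, upSum, ← mul_assoc, mul_add, add_comm, Finset.mul_sum,
    Finset.sum_congr rfl fun z hz => ih z (Finset.mem_filter.1 hz).2.lt]
  simp [hm]

end PathSums

/-! ### Coordinates in the rectangle -/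

namespace Rect

variable {p q : ℕ}

theorem ext_iff {x y : Rect p q} : x = y ↔ x.1.1 = y.1.1 ∧ x.2.1 = y.2.1 := by
  rw [Prod.ext_iff, Subtype.ext_iff, Subtype.ext_iff]

theorem le_iff {x y : Rect p q} : x ≤ y ↔ x.1.1 ≤ y.1.1 ∧ x.2.1 ≤ y.2.1 := Iff.rfl

theorem bounds (x : Rect p q) : (1 ≤ x.1.1 ∧ x.1.1 ≤ p) ∧ 1 ≤ x.2.1 ∧ x.2.1 ≤ q :=
  ⟨x.1.2, x.2.2⟩

/-- The element of the rectangle with given coordinates. -/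
def point (i j : ℕ) (hi : 1 ≤ i ∧ i ≤ p) (hj : 1 ≤ j ∧ j ≤ q) : Rect p q := (⟨i, hi⟩, ⟨j, hj⟩)

theorem lt_iff {x y : Rect p q} :
    x < y ↔ (x.1.1 ≤ y.1.1 ∧ x.2.1 ≤ y.2.1) ∧ (x.1.1 ≠ y.1.1 ∨ x.2.1 ≠ y.2.1) := by
  rw [lt_iff_le_and_ne, le_iff, Ne, ext_iff]
  tauto

theorem covBy_iff {x y : Rect p q} :
    x ⋖ y ↔ (x.1.1 = y.1.1 ∧ x.2.1 + 1 = y.2.1) ∨ (x.1.1 + 1 = y.1.1 ∧ x.2.1 = y.2.1) := by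
  have hx := bounds x
  have hy := bounds y
  constructor
  · rintro ⟨h1, h2⟩
    rw [lt_iff] at h1
    by_cases h : x.1.1 = y.1.1
    · have := @h2 (point x.1.1 (x.2.1 + 1) hx.1 (by omega))
      simp only [lt_iff, point] at this
      omega
    · have := @h2 (point (x.1.1 + 1) x.2.1 (by omega) hx.2)
      simp only [lt_iff, point] at this
      omega
  · intro h
    refine ⟨lt_iff.2 (by omega), fun z h1 h2 => ?_⟩
    rw [lt_iff] at h1 h2
    omega

theorem isMin_iff {x : Rect p q} : IsMin x ↔ x.1.1 = 1 ∧ x.2.1 = 1 := by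
  have hx := bounds x
  constructor
  · intro h
    have := @h (point 1 1 (by omega) (by omega)) (by simp only [le_iff, point]; omega)
    simp only [le_iff, point] at this
    omega
  · intro h y hy
    have := bounds y
    rw [le_iff] at hy ⊢
    omega

theorem isMax_iff {x : Rect p q} : IsMax x ↔ x.1.1 = p ∧ x.2.1 = q := by
  have hx := bounds x
  constructor
  · intro h
    have := @h (point p q (by omega) (by omega)) (by simp only [le_iff, point]; omega)
    simp only [le_iff, point] at this
    omega
  · intro h y hy
    have := bounds y
    rw [le_iff] at hy ⊢
    omega

/-! ### Shifting path sums by one step in time -/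

/-- `Jump x y` means that `y` lies one rank below `x` and weakly beyond it in the first
coordinate. -/
def Jump (x y : Rect p q) : Prop :=
  x.1.1 + x.2.1 = y.1.1 + y.2.1 + 1 ∧ x.1.1 ≤ y.1.1

open scoped Classical in
/-- The saturated chains `z ⋖ w ⋖ x` whose upper step is a jump and those whose lower step is one
are equinumerous. -/
theorem card_jump_upper_eq_card_jump_lower (x z : Rect p q) :
    (Finset.univ.filter fun w => (w ⋖ x ∧ z ⋖ w) ∧ Jump x w).card =
      (Finset.univ.filter fun w => (w ⋖ x ∧ z ⋖ w) ∧ Jump w z).card := by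
  have hx := bounds x
  have hz := bounds z
  by_cases h : z.1.1 + 1 = x.1.1 ∧ z.2.1 + 1 = x.2.1
  · have h1 : (Finset.univ.filter fun w => (w ⋖ x ∧ z ⋖ w) ∧ Jump x w) =
        {point x.1.1 z.2.1 hx.1 hz.2} := by
      ext w
      simp only [Finset.mem_filter_univ, Finset.mem_singleton, covBy_iff, Jump, ext_iff, point]
      omega
    have h2 : (Finset.univ.filter fun w => (w ⋖ x ∧ z ⋖ w) ∧ Jump w z) =
        {point z.1.1 x.2.1 hz.1 hx.2} := by
      ext w
      simp only [Finset.mem_filter_univ, Finset.mem_singleton, covBy_iff, Jump, ext_iff, point]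
      omega
    rw [h1, h2, Finset.card_singleton, Finset.card_singleton]
  · congr 1
    ext w
    simp only [Finset.mem_filter_univ, covBy_iff, Jump]
    omega

variable {K : Type*} [Ring K]

open scoped Classical in
-- For `w ≠ y` the two jump conditions are equivalent: both say that `w` comes before `y` on their
-- common rank. For `w = y` the factors `X w` and `(X y)⁻¹` cancel, and only the number of
-- admissible `w` matters.
theorem sum_jump_upper_eq_sum_jump_lower (E F : Rect p q → K) (X : Rect p q → Kˣ) :
    ∑ x, ∑ z, ∑ w, ∑ y, (if (w ⋖ x ∧ z ⋖ y) ∧ Jump x y then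
        E x * X w * ((X y)⁻¹ : Kˣ) * F z else 0) =
      ∑ x, ∑ z, ∑ w, ∑ y, (if (w ⋖ x ∧ z ⋖ y) ∧ Jump w z then
        E x * X w * ((X y)⁻¹ : Kˣ) * F z else 0) := by
  refine Finset.sum_congr rfl fun x _ => Finset.sum_congr rfl fun z _ => ?_
  rw [← sub_eq_zero]
  simp only [← Finset.sum_sub_distrib]
  have hdiag : ∀ w : Rect p q, (∑ y, ((if (w ⋖ x ∧ z ⋖ y) ∧ Jump x y then
        E x * X w * ((X y)⁻¹ : Kˣ) * F z else 0) - if (w ⋖ x ∧ z ⋖ y) ∧ Jump w z then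
        E x * X w * ((X y)⁻¹ : Kˣ) * F z else 0)) =
      (if (w ⋖ x ∧ z ⋖ w) ∧ Jump x w then E x * F z else 0) -
        if (w ⋖ x ∧ z ⋖ w) ∧ Jump w z then E x * F z else 0 := by
    intro w
    rw [Finset.sum_eq_single w]
    · rw [mul_assoc (E x), Units.mul_inv, mul_one]
    · intro y _ hy
      have : ((w ⋖ x ∧ z ⋖ y) ∧ Jump x y) ↔ ((w ⋖ x ∧ z ⋖ y) ∧ Jump w z) := by
        rw [Ne, ext_iff] at hy
        simp only [covBy_iff, Jump]
        omega
      rw [if_congr this rfl rfl, sub_self]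
    · simp
  simp only [hdiag]
  rw [Finset.sum_sub_distrib, ← Finset.sum_filter, ← Finset.sum_filter, Finset.sum_const,
    Finset.sum_const, card_jump_upper_eq_card_jump_lower, sub_self]

set_option maxHeartbeats 1000000 in
open scoped Classical in
/-- Moving both endpoints of a path sum by one step along the edges of the rectangle exchanges the
weights `x * (downSum x)⁻¹` and `(upSum x⁻¹)⁻¹ * x⁻¹`. -/
theorem conversion {A V E F : Rect p q → K} {X : Rect p q → Kˣ} {a c : K} {u u' d d' : Rect p q}
    (hA : ∀ x, A x * downSum a (fun v => (X v : K)) x = X x)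
    (hV : ∀ x, upSum c (fun v => (((X v)⁻¹ : Kˣ) : K)) x * V x = ((X x)⁻¹ : Kˣ))
    (hE : ∀ x, E x = ((if x = u then 1 else 0) + ∑ z with x ⋖ z, E z) * A x)
    (hF : ∀ y, F y = V y * ((if y = d' then 1 else 0) + ∑ z with z ⋖ y, F z))
    (hu : u.1.1 = p) (hu' : u'.1.1 = p) (huu : u.2.1 = u'.2.1 + 1)
    (hd : d.1.1 = 1) (hd' : d'.1.1 = 1) (hdd : d.2.1 = d'.2.1 + 1) : E d = F u' := by
  -- `G` and `H` are the path sums with the weight at the moving endpoint removed: `E x = G x * A x`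
  -- and `F y = V y * H y`. The sum of `G x * X x * (X y)⁻¹ * H y` over all jumps is evaluated in
  -- two ways.
  set G : Rect p q → K := fun x => (if x = u then 1 else 0) + ∑ z with x ⋖ z, E z with hG
  set H : Rect p q → K := fun y => (if y = d' then 1 else 0) + ∑ z with z ⋖ y, F z with hH
  have hGX : ∀ x y, Jump x y → G x * X x = E x * ∑ w with w ⋖ x, (X w : K) := by
    intro x y hxy
    have hm : ¬ IsMin x := by
      have := bounds y
      rw [isMin_iff]
      simp only [Jump] at hxy
      omega
    rw [← hA x, downSum, if_neg hm, add_zero, ← mul_assoc, ← hE]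
  have hYH : ∀ x y, Jump x y → ((X y)⁻¹ : Kˣ) * H y =
      (∑ w with y ⋖ w, (((X w)⁻¹ : Kˣ) : K)) * F y := by
    intro x y hxy
    have hm : ¬ IsMax y := by
      have := bounds x
      rw [isMax_iff]
      simp only [Jump] at hxy
      omega
    rw [← hV y, upSum, if_neg hm, add_zero, mul_assoc, ← hF]
  -- First evaluation: `G x * X x` becomes `E x` times a lower sum, and `H y` is unfolded.
  have h1 : ∑ x, ∑ y, (if Jump x y then G x * X x * (((X y)⁻¹ : Kˣ) * H y) else 0) =
      E d + ∑ x, ∑ z, ∑ w, ∑ y, (if (w ⋖ x ∧ z ⋖ y) ∧ Jump x y then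
        E x * X w * ((X y)⁻¹ : Kˣ) * F z else 0) := by
    have hx : ∀ x y, (if Jump x y then G x * X x * (((X y)⁻¹ : Kˣ) * H y) else 0) =
        (if x = d ∧ y = d' then E d else 0) + ∑ z, ∑ w, (if (w ⋖ x ∧ z ⋖ y) ∧ Jump x y then
          E x * X w * ((X y)⁻¹ : Kˣ) * F z else 0) := by
      intro x y
      by_cases hxy : Jump x y
      · rw [if_pos hxy, hGX x y hxy]
        simp only [hH, mul_add]
        congr 1
        -- A jump ending at `d'` must start at `d`, since `d'` has first coordinate `1`. The only
        -- lower cover of `d` is `d'`, so the labels cancel and `E d` remains.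
        · by_cases hy : y = d'
          · have hxd : x = d := by
              have := bounds x
              rw [ext_iff] at hy ⊢
              simp only [Jump] at hxy
              omega
            have hw : (Finset.univ.filter fun w => w ⋖ d) = {d'} := by
              ext w
              have := bounds w
              simp only [Finset.mem_filter_univ, Finset.mem_singleton, covBy_iff, ext_iff]
              omega
            rw [if_pos hy, if_pos ⟨hxd, hy⟩, hxd, hy, hw, Finset.sum_singleton, mul_one, mul_assoc,
              Units.mul_inv, mul_one]
          · rw [if_neg hy, if_neg (fun h => hy h.2), mul_zero, mul_zero]
        · simp only [Finset.mul_sum, Finset.sum_mul, Finset.sum_filter, hxy, and_true, ite_and,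
            mul_assoc, mul_ite, mul_zero, ite_mul, zero_mul]
          refine Finset.sum_congr rfl fun z _ => ?_
          split_ifs <;> simp
      · have : ¬ (x = d ∧ y = d') := by
          rintro ⟨rfl, rfl⟩
          exact hxy ⟨by omega, by omega⟩
        simp [hxy, this]
    simp only [hx, Finset.sum_add_distrib]
    congr 1
    · simp [ite_and]
    · refine Finset.sum_congr rfl fun x _ => ?_
      rw [Finset.sum_comm]
      exact Finset.sum_congr rfl fun z _ => Finset.sum_comm
  -- Second evaluation: `G` is unfolded and `(X z)⁻¹ * H z` becomes an upper sum times `F z`. The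
  -- boundary term is now the jump from `u` to `u'`.
  have h2 : ∑ w, ∑ z, (if Jump w z then G w * X w * (((X z)⁻¹ : Kˣ) * H z) else 0) =
      F u' + ∑ x, ∑ z, ∑ w, ∑ y, (if (w ⋖ x ∧ z ⋖ y) ∧ Jump w z then
        E x * X w * ((X y)⁻¹ : Kˣ) * F z else 0) := by
    have hx : ∀ w z, (if Jump w z then G w * X w * (((X z)⁻¹ : Kˣ) * H z) else 0) =
        (if w = u ∧ z = u' then F u' else 0) + ∑ x, ∑ y, (if (w ⋖ x ∧ z ⋖ y) ∧ Jump w z then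
          E x * X w * ((X y)⁻¹ : Kˣ) * F z else 0) := by
      intro w z
      by_cases hxy : Jump w z
      · rw [if_pos hxy, hYH w z hxy]
        simp only [hG, add_mul]
        congr 1
        · by_cases hy : w = u
          · have hxd : z = u' := by
              have := bounds z
              rw [ext_iff] at hy ⊢
              simp only [Jump] at hxy
              omega
            have hw : (Finset.univ.filter fun y => u' ⋖ y) = {u} := by
              ext w
              have := bounds w
              simp only [Finset.mem_filter_univ, Finset.mem_singleton, covBy_iff, ext_iff]
              omega
            rw [if_pos hy, if_pos ⟨hy, hxd⟩, hxd, hy, hw, Finset.sum_singleton, one_mul,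
              ← mul_assoc, Units.mul_inv, one_mul]
          · rw [if_neg hy, if_neg (fun h => hy h.1), zero_mul, zero_mul]
        · simp only [Finset.mul_sum, Finset.sum_mul, Finset.sum_filter, hxy, and_true, ite_and,
            mul_assoc, mul_ite, mul_zero, ite_mul, zero_mul]
          rw [Finset.sum_comm]
          refine Finset.sum_congr rfl fun x _ => ?_
          split_ifs <;> simp
      · have : ¬ (w = u ∧ z = u') := by
          rintro ⟨rfl, rfl⟩
          exact hxy ⟨by omega, by omega⟩
        simp [hxy, this]
    simp only [hx, Finset.sum_add_distrib]
    congr 1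
    · simp [ite_and]
    · rw [Finset.sum_comm]
      symm
      rw [Finset.sum_comm]
      exact Finset.sum_congr rfl fun z _ => Finset.sum_comm
  have h := h1.symm.trans h2
  rw [sum_jump_upper_eq_sum_jump_lower] at h
  exact add_right_cancel h

end Rect

/-! ### Reciprocity for invertible labels -/

namespace Rect

variable {p q : ℕ}

/-- The point reflection of the rectangle in its centre. -/
def antipode (v : Rect p q) : Rect p q := (v.1.flip, v.2.flip)

theorem antipode_fst (v : Rect p q) : (antipode v).1.1 = p + 1 - v.1.1 := rfl

theorem antipode_snd (v : Rect p q) : (antipode v).2.1 = q + 1 - v.2.1 := rfl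

theorem antipode_involutive : Function.Involutive (antipode : Rect p q → Rect p q) := by
  intro v
  have := bounds v
  rw [ext_iff]
  simp only [antipode_fst, antipode_snd]
  omega

theorem antipode_covBy_antipode {v w : Rect p q} : antipode v ⋖ antipode w ↔ w ⋖ v := by
  have := bounds v
  have := bounds w
  simp only [covBy_iff, antipode_fst, antipode_snd]
  omega

theorem isMin_antipode {v : Rect p q} : IsMin (antipode v) ↔ IsMax v := by
  have := bounds v
  simp only [isMin_iff, isMax_iff, antipode_fst, antipode_snd]
  omega

variable {K : Type*} [Ring K]

theorem downSum_antipode (a : K) (f : Rect p q → K) (v : Rect p q) :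
    downSum a f (antipode v) = upSum a (fun u => f (antipode u)) v := by
  classical
  rw [downSum, upSum, if_congr isMin_antipode rfl rfl]
  congr 1
  symm
  refine Finset.sum_equiv antipode_involutive.toPerm (fun u => ?_) fun u _ => rfl
  simp [antipode_covBy_antipode]

theorem upSum_antipode (c : K) (f : Rect p q → K) (v : Rect p q) :
    upSum c f (antipode v) = downSum c (fun u => f (antipode u)) v := by
  conv_rhs => rw [← antipode_involutive v, downSum_antipode]
  simp only [antipode_involutive _]

section UnitLabels

variable {ℓ : ℕ} {x : ℕ → Rect p q → Kˣ} {a b : Kˣ}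

/-- The weight `x * (downSum x)⁻¹` at time `t`. -/
noncomputable def downWeight (x : ℕ → Rect p q → Kˣ) (a : Kˣ) (t : ℕ) (v : Rect p q) : K :=
  x t v * Ring.inverse (downSum (a : K) (fun u => (x t u : K)) v)

variable (ℓ x a b) in
/-- The sequence `x` of labelings by invertible elements satisfies the transition equations of
rowmotion up to time `ℓ`. -/
structure IsOrbit : Prop where
  isUnit_upSum : ∀ t < ℓ, ∀ v,
    IsUnit (upSum ((b⁻¹ : Kˣ) : K) (fun u => (((x (t + 1) u)⁻¹ : Kˣ) : K)) v)
  transition : ∀ t < ℓ, ∀ v,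
    (x (t + 1) v : K) * upSum ((b⁻¹ : Kˣ) : K) (fun u => (((x (t + 1) u)⁻¹ : Kˣ) : K)) v * x t v =
      downSum (a : K) (fun u => (x t u : K)) v

namespace IsOrbit

theorem isUnit_downSum (h : IsOrbit ℓ x a b) {t : ℕ} (ht : t < ℓ) (v : Rect p q) :
    IsUnit (downSum (a : K) (fun u => (x t u : K)) v) := by
  rw [← h.transition t ht v]
  exact ((x (t + 1) v).isUnit.mul (h.isUnit_upSum t ht v)).mul (x t v).isUnit

theorem downWeight_mul_downSum (h : IsOrbit ℓ x a b) {t : ℕ} (ht : t < ℓ) (v : Rect p q) :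
    downWeight x a t v * downSum (a : K) (fun u => (x t u : K)) v = x t v := by
  rw [downWeight, mul_assoc, Ring.inverse_mul_cancel _ (h.isUnit_downSum ht v), mul_one]

/-- The transition equation lets the weight defined from time `t` also govern the inverse labels at
time `t + 1`. This is the link between consecutive times. -/
theorem upSum_mul_downWeight (h : IsOrbit ℓ x a b) {t : ℕ} (ht : t < ℓ) (v : Rect p q) :
    upSum ((b⁻¹ : Kˣ) : K) (fun u => (((x (t + 1) u)⁻¹ : Kˣ) : K)) v * downWeight x a t v =
      ((x (t + 1) v)⁻¹ : Kˣ) := by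
  have h1 := Ring.mul_inverse_cancel _ (h.isUnit_downSum ht v)
  nth_rewrite 1 [← h.transition t ht v] at h1
  refine (Units.inv_eq_of_mul_eq_one_right ?_).symm
  rw [downWeight, ← h1]
  simp only [mul_assoc]

theorem pathSum_downWeight_succ (h : IsOrbit ℓ x a b) {t : ℕ} (ht : t + 1 < ℓ)
    {u u' d d' : Rect p q} (hu : u.1.1 = p) (hu' : u'.1.1 = p) (huu : u.2.1 = u'.2.1 + 1)
    (hd : d.1.1 = 1) (hd' : d'.1.1 = 1) (hdd : d.2.1 = d'.2.1 + 1) :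
    pathSum (downWeight x a (t + 1)) u d = pathSum (downWeight x a t) u' d' :=
  conversion (E := fun v => pathSum (downWeight x a (t + 1)) u v)
    (F := fun v => pathSum (downWeight x a t) v d') (fun v => h.downWeight_mul_downSum ht v)
    (fun v => h.upSum_mul_downWeight (by omega) v) (fun v => by convert pathSum_apply_right _ u v)
    (fun v => by convert pathSum_apply_left _ v d') hu hu' huu hd hd' hdd

theorem pathSum_downWeight_add (h : IsOrbit ℓ x a b) {t : ℕ} (n : ℕ) (ht : t + n < ℓ)
    {u u' d d' : Rect p q} (hu : u.1.1 = p) (hu' : u'.1.1 = p) (huu : u.2.1 = u'.2.1 + n)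
    (hd : d.1.1 = 1) (hd' : d'.1.1 = 1) (hdd : d.2.1 = d'.2.1 + n) :
    pathSum (downWeight x a (t + n)) u d = pathSum (downWeight x a t) u' d' := by
  induction n generalizing u d with
  | zero =>
    rw [show u = u' by rw [ext_iff]; omega, show d = d' by rw [ext_iff]; omega, add_zero]
  | succ n ih =>
    have bu := bounds u
    have bd := bounds d
    have bu' := bounds u'
    have bd' := bounds d'
    rw [← ih (by omega) (u := point p (u.2.1 - 1) (by omega) (by omega))
      (d := point 1 (d.2.1 - 1) (by omega) (by omega)) rfl (by simp only [point]; omega) rfl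
      (by simp only [point]; omega)]
    exact h.pathSum_downWeight_succ (by omega) hu rfl (by simp only [point]; omega) hd rfl
      (by simp only [point]; omega)

/-- The inverse label at `v` is a path sum from `(p, q)` to `v`. Shifting it `v.2.1 - 1` times makes
it end at `(1, 1)` and start at the antipode of `v`, where it computes a label. -/
theorem reciprocity_of_fst_eq_one (h : IsOrbit ℓ x a b) {v : Rect p q} (hv : v.1.1 = 1) {t : ℕ}
    (ht : t ≤ ℓ) (hvt : v.2.1 ≤ t) :
    b * (x t v)⁻¹ * a = x (t - v.2.1) (antipode v) := by
  have bv := bounds v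
  have hmax : ∀ w : Rect p q, IsMax w ↔ w = point p q (by omega) (by omega) := fun w => by
    rw [isMax_iff, ext_iff]; rfl
  have hmin : ∀ w : Rect p q, IsMin w ↔ w = point 1 1 (by omega) (by omega) := fun w => by
    rw [isMin_iff, ext_iff]; rfl
  obtain ⟨n, hn⟩ : ∃ n, v.2.1 = n + 1 := ⟨v.2.1 - 1, by omega⟩
  obtain ⟨s, rfl⟩ : ∃ s, t = s + n + 1 := ⟨t - (n + 1), by omega⟩
  have h1 := eq_mul_pathSum hmax (h.upSum_mul_downWeight (t := s + n) (by omega)) v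
  have h2 := eq_pathSum_mul hmin (h.downWeight_mul_downSum (t := s) (by omega)) (antipode v)
  have h3 := h.pathSum_downWeight_add (t := s) n (by omega)
    (u := point p q (by omega) (by omega)) (u' := antipode v) (d := v)
    (d' := point 1 1 (by omega) (by omega)) rfl (by rw [antipode_fst]; omega)
    (by rw [antipode_snd]; simp only [point]; omega) hv rfl (by simp only [point]; omega)
  rw [show s + n + 1 - v.2.1 = s by omega]
  ext
  rw [Units.val_mul, Units.val_mul, h1, h2, h3, Units.mul_inv_cancel_left]

theorem reciprocity (h : IsOrbit ℓ x a b) {v : Rect p q} {t : ℕ} (ht : t ≤ ℓ)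
    (hvt : v.1.1 + v.2.1 ≤ t + 1) :
    b * (x t v)⁻¹ * a = x (t + 1 - (v.1.1 + v.2.1)) (antipode v) := by
  classical
  induction hi : v.1.1 using Nat.strong_induction_on generalizing v t with
  | _ i ih =>
  subst hi
  have IH : ∀ {k : ℕ} {w : Rect p q} {s : ℕ}, w.1.1 < v.1.1 → s ≤ ℓ → w.1.1 + w.2.1 ≤ s + 1 →
      s + 1 - (w.1.1 + w.2.1) = k → b * (x s w)⁻¹ * a = x k (antipode w) := by
    rintro k w s h1 h2 h3 rfl
    exact ih _ h1 h2 h3 rfl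
  clear ih
  have bv := bounds v
  by_cases hv : v.1.1 = 1
  · rw [h.reciprocity_of_fst_eq_one hv ht (by omega)]
    congr 1
    omega
  obtain ⟨t, rfl⟩ : ∃ s, t = s + 1 := ⟨t - 1, by omega⟩
  -- `v` covers `w`. The lower covers of `w` and its other possible upper cover all have first
  -- coordinate below that of `v`, so the induction hypothesis applies to them.
  let w : Rect p q := point (v.1.1 - 1) v.2.1 (by omega) bv.2
  have hw1 : w.1.1 = v.1.1 - 1 := rfl
  have hw2 : w.2.1 = v.2.1 := rfl
  obtain ⟨k, hk⟩ : ∃ k, k = t + 1 + 1 - (v.1.1 + v.2.1) := ⟨_, rfl⟩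
  rw [← hk]
  have e1 : b * (x (t + 1) w)⁻¹ * a = x (k + 1) (antipode w) :=
    IH (by omega) ht (by omega) (by omega)
  have e2 : b * (x t w)⁻¹ * a = x k (antipode w) :=
    IH (by omega) (by omega) (by omega) (by omega)
  have e3 : downSum (a : K) (fun u => (x t u : K)) w =
      a * upSum ((b⁻¹ : Kˣ) : K) (fun u => (((x (k + 1) u)⁻¹ : Kˣ) : K)) (antipode w) * b := by
    rw [upSum_antipode, downSum, downSum, mul_add, add_mul, Finset.mul_sum, Finset.sum_mul]
    congr 1
    · refine Finset.sum_congr rfl fun z hz => ?_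
      have hz := covBy_iff.1 (Finset.mem_filter.1 hz).2
      have bz := bounds z
      have e : b * (x t z)⁻¹ * a = x (k + 1) (antipode z) :=
        IH (by omega) (by omega) (by omega) (by omega)
      rw [← e, ← Units.val_mul, ← Units.val_mul]
      congr 1
      group
    · split_ifs <;> simp
  -- The transition from `t` to `t + 1` at `w` turns into the one from `k` to `k + 1` at the
  -- antipode of `w`.
  have e4 : b * upSum ((b⁻¹ : Kˣ) : K) (fun u => (((x (t + 1) u)⁻¹ : Kˣ) : K)) w * a =
      downSum (a : K) (fun u => (x k u : K)) (antipode w) := by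
    rw [← h.transition k (by omega), ← e1, ← e2]
    have h1 := h.transition t (by omega) w
    rw [e3] at h1
    have h2 := congrArg (fun y : K => ((x (t + 1) w)⁻¹ : Kˣ) * y * ((x t w)⁻¹ : Kˣ)) h1
    simp only [mul_assoc, Units.mul_inv, mul_one, Units.inv_mul_cancel_left] at h2
    rw [h2]
    simp only [Units.val_mul, mul_assoc]
  rw [downSum_antipode, upSum, upSum, mul_add, add_mul, Finset.mul_sum, Finset.sum_mul] at e4
  have e5 : (b : K) * (if IsMax w then ((b⁻¹ : Kˣ) : K) else 0) * a =
      if IsMax w then (a : K) else 0 := by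
    split_ifs <;> simp
  -- All summands other than the one at `v` agree by induction, so the one at `v` agrees too.
  rw [e5, add_left_inj, ← sub_eq_zero, ← Finset.sum_sub_distrib, Finset.sum_eq_single v] at e4
  · ext
    rw [Units.val_mul, Units.val_mul]
    exact sub_eq_zero.1 e4
  · intro z hz hzv
    have hz := covBy_iff.1 (Finset.mem_filter.1 hz).2
    rw [Ne, ext_iff] at hzv
    have e : b * (x (t + 1) z)⁻¹ * a = x k (antipode z) :=
      IH (by omega) (by omega) (by omega) (by omega)
    rw [← e, Units.val_mul, Units.val_mul, sub_self]
  · intro hv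
    refine absurd (Finset.mem_filter.2 ⟨Finset.mem_univ _, ?_⟩) hv
    rw [covBy_iff]
    omega

end IsOrbit

end UnitLabels

/-- The transition equations of rowmotion imply reciprocity if all labels are invertible. -/
theorem reciprocity_of_isUnit {ℓ : ℕ} {y : ℕ → Rect p q → K} {a b : K} (ha : IsUnit a)
    (hb : IsUnit b) (hy : ∀ t ≤ ℓ, ∀ v, IsUnit (y t v))
    (hU : ∀ t < ℓ, ∀ v, IsUnit (upSum (Ring.inverse b) (fun u => Ring.inverse (y (t + 1) u)) v))
    (h : ∀ t < ℓ, ∀ v, y (t + 1) v = downSum a (y t) v * Ring.inverse (y t v) *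
      Ring.inverse (upSum (Ring.inverse b) (fun u => Ring.inverse (y (t + 1) u)) v))
    {v : Rect p q} (hv : v.1.1 + v.2.1 ≤ ℓ + 1) :
    y ℓ v = a * Ring.inverse (y (ℓ + 1 - (v.1.1 + v.2.1)) (antipode v)) * b := by
  classical
  obtain ⟨a, rfl⟩ := ha
  obtain ⟨b, rfl⟩ := hb
  let x : ℕ → Rect p q → Kˣ := fun t v => if ht : t ≤ ℓ then (hy t ht v).unit else 1
  have hx : ∀ t ≤ ℓ, ∀ v, y t v = x t v := fun t ht v => by simp [x, ht]
  have hx' : ∀ t < ℓ, ∀ v, upSum (Ring.inverse (b : K))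
      (fun u => Ring.inverse (y (t + 1) u)) v =
        upSum ((b⁻¹ : Kˣ) : K) (fun u => (((x (t + 1) u)⁻¹ : Kˣ) : K)) v := fun t ht v => by
    simp only [hx _ ht, Ring.inverse_unit]
  have horb : IsOrbit ℓ x a b := by
    refine ⟨fun t ht v => hx' t ht v ▸ hU t ht v, fun t ht v => ?_⟩
    have h1 := h t ht v
    rw [hx _ ht, hx' t ht, hx _ ht.le] at h1
    rw [h1, mul_assoc (_ * _), mul_assoc (_ * _),
      Ring.inverse_mul_cancel_left _ _ (hx' t ht v ▸ hU t ht v), mul_assoc, Ring.inverse_mul_cancel _ (Units.isUnit _), mul_one]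
    congr 1
    exact funext fun u => hx _ ht.le u
  have hr := horb.reciprocity le_rfl hv
  have bv := bounds v
  rw [hx _ le_rfl, hx _ (by omega), ← hr, Ring.inverse_unit, ← Units.val_mul, ← Units.val_mul]
  congr 1
  group

end Rect

/-! ### From partial maps to invertible labels -/

theorem mainTheorem2 {K : Type*} [Ring K] (p q : ℕ) (ℓ : ℕ)
    (f g : Labeling (Rect p q) K)
    (hg : PartialMap.pow (rowmotion (Rect p q) K) ℓ f = some g)
    (a b : K) (ha : a = f ⊥) (hb : b = f ⊤)
    (i : Chain p) (j : Chain q) (hij : (0 : ℤ) ≤ (ℓ : ℤ) - i - j + 1) :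
    ∃ h : Labeling (Rect p q) K,
      PartialMap.pow (rowmotion (Rect p q) K) (ℓ + 1 - (i + j)) f = some h ∧
      IsUnit (h (ExtPoset.ofElem (i.flip, j.flip))) ∧
      g (ExtPoset.ofElem (i, j)) =
        a * Ring.inverse (h (ExtPoset.ofElem (i.flip, j.flip))) * b := by
  classical
  subst ha hb
  obtain ⟨F, rfl, rfl, hF, hstep⟩ := PartialMap.exists_orbit hg
  have hi : 1 ≤ i.1 ∧ i.1 ≤ p := i.2
  have hj : 1 ≤ j.1 ∧ j.1 ≤ q := j.2
  have htr := fun t ht => transitionAt_of_rowmotion (hstep t ht)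
  have hbot : ∀ t ≤ ℓ, F t ⊥ = F 0 ⊥ := fun t ht => by
    induction t with
    | zero => rfl
    | succ t ih => rw [(htr t ht).1, ih (by omega)]
  have htop : ∀ t ≤ ℓ, F t ⊤ = F 0 ⊤ := fun t ht => by
    induction t with
    | zero => rfl
    | succ t ih => rw [(htr t ht).2.1, ih (by omega)]
  refine ⟨F (ℓ + 1 - (i + j)), hF _ (by omega), ?_, ?_⟩
  -- As `i + j ≥ 2`, this time is below `ℓ`, so the next rowmotion step inverts the label.
  · exact ((htr _ (by omega)).2.2 _).isUnit_self
  have hbu : IsUnit (F 0 ⊤) := by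
    rw [← htop 1 (by omega)]
    refine ((htr 0 (by omega)).2.2 (Rect.point p q (by omega) (by omega))).isUnit_upper _ ?_
    rw [ExtPoset.ofElem_covBy_top, Rect.isMax_iff]
    exact ⟨rfl, rfl⟩
  have hup : ∀ t < ℓ, ∀ v, IsUnit (upSum (Ring.inverse (F 0 ⊤))
      (fun u => Ring.inverse (F (t + 1) (ExtPoset.ofElem u))) v) := fun t ht v => by
    have h1 := ((htr t ht).2.2 v).isUnit_upperInvSum
    rwa [upperInvSum_eq_upSum, htop _ ht] at h1
  have heq : ∀ t < ℓ, ∀ v, F (t + 1) (ExtPoset.ofElem v) =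
      downSum (F 0 ⊥) (fun u => F t (ExtPoset.ofElem u)) v *
        Ring.inverse (F t (ExtPoset.ofElem v)) * Ring.inverse (upSum (Ring.inverse (F 0 ⊤))
          (fun u => Ring.inverse (F (t + 1) (ExtPoset.ofElem u))) v) := fun t ht v => by
    have h1 := ((htr t ht).2.2 v).eq
    rwa [upperInvSum_eq_upSum, lowerSum_eq_downSum, htop _ ht, hbot _ ht.le] at h1
  have hmin : ∀ (c : K) (y : Rect p q → K) {v : Rect p q}, IsMin v → downSum c y v = c := by
    intro c y v hv
    rw [downSum, if_pos hv, Finset.filter_false_of_mem, Finset.sum_empty, zero_add]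
    exact fun u _ hu => hv.not_lt hu.lt
  have hnotmin : ∀ t < ℓ, ∀ v : Rect p q, ¬ IsMin v → IsUnit (F (t + 1) (ExtPoset.ofElem v)) := by
    intro t ht v hv
    obtain ⟨u, hu⟩ := exists_covBy_of_wellFoundedGT hv
    exact ((htr t ht).2.2 u).isUnit_upper _ (ExtPoset.ofElem_covBy_ofElem.2 hu)
  have hself : ∀ t < ℓ, ∀ v, IsUnit (F t (ExtPoset.ofElem v)) := fun t ht v =>
    ((htr t ht).2.2 v).isUnit_self
  -- For `ℓ = 1` only `i = j = 1` is possible, and nothing forces `a` to be a unit.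
  rcases (show ℓ = 1 ∨ 2 ≤ ℓ by omega) with rfl | hl
  · have hm : IsMin ((i, j) : Rect p q) := Rect.isMin_iff.2 (by simp only; omega)
    let U : Rect p q → K := upSum (Ring.inverse (F 0 ⊤))
      (fun u => Ring.inverse (F 1 (ExtPoset.ofElem u)))
    -- This is the orbit with `a` replaced by `1`. Only the label at the minimum at time `1`
    -- changes, and multiplying it by `a` on the left restores it.
    let y : ℕ → Rect p q → K := fun t v =>
      if t = 1 ∧ IsMin v then Ring.inverse (F 0 (ExtPoset.ofElem v)) * Ring.inverse (U v)
      else F t (ExtPoset.ofElem v)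
    have hy0 : y 0 = fun v => F 0 (ExtPoset.ofElem v) := funext fun v => by simp [y]
    have hyU : ∀ v, upSum (Ring.inverse (F 0 ⊤)) (fun u => Ring.inverse (y 1 u)) v = U v := by
      intro v
      simp only [U, upSum]
      congr 1
      refine Finset.sum_congr rfl fun u hu => ?_
      have : ¬ IsMin u := fun h => h.not_lt (Finset.mem_filter.1 hu).2.lt
      simp [y, this]
    have hyu : ∀ t ≤ 1, ∀ v, IsUnit (y t v) := by
      intro t ht v
      rcases (show t = 0 ∨ t = 1 by omega) with rfl | rfl
      · rw [hy0]
        exact hself 0 one_pos v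
      · simp only [y]
        split_ifs with h
        · exact (hself 0 one_pos v).ringInverse.mul (hup 0 one_pos v).ringInverse
        · exact hnotmin 0 one_pos v (by simpa using h)
    have key := Rect.reciprocity_of_isUnit (ℓ := 1) (y := y) (a := 1) isUnit_one hbu hyu
      (fun t ht v => by
        obtain rfl : t = 0 := by omega
        rw [hyU]
        exact hup 0 one_pos v)
      (fun t ht v => by
        obtain rfl : t = 0 := by omega
        rw [hyU, hy0]
        by_cases h : IsMin v
        · rw [hmin _ _ h, one_mul]
          simp [y, h]
        · have h1 := heq 0 one_pos v
          simp only [downSum, if_neg h] at h1 ⊢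
          simpa [y, h] using h1) (v := (i, j)) (by simp only; omega)
    have hz : 1 + 1 - (i.1 + j.1) = 0 := by omega
    simp only [hz, hy0, one_mul] at key ⊢
    rw [mul_assoc]
    refine Eq.trans ?_ (congrArg (F 0 ⊥ * ·) key)
    rw [heq 0 one_pos, hmin _ _ hm]
    simp [y, hm, U, mul_assoc]
  -- The second rowmotion step inverts the label at the minimum at time `1`, which is `a` times two
  -- units.
  · have hau : IsUnit (F 0 ⊥) := by
      let m : Rect p q := Rect.point 1 1 (by omega) (by omega)
      have hm : IsMin m := Rect.isMin_iff.2 ⟨rfl, rfl⟩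
      have h1 := hself 1 (by omega) m
      obtain ⟨c, hc⟩ := (hself 0 (by omega) m).ringInverse
      obtain ⟨d, hd⟩ := (hup 0 (by omega) m).ringInverse
      rwa [heq 0 (by omega), hmin _ _ hm, ← hc, ← hd, Units.isUnit_mul_units,
        Units.isUnit_mul_units] at h1
    -- No later step inverts the labels at time `ℓ`. Non-minimal ones were inverted as upper covers
    -- during the last step, and the minimal one is a product of units.
    have hlast : ∀ v, IsUnit (F ℓ (ExtPoset.ofElem v)) := by
      obtain ⟨n, rfl⟩ : ∃ n, ℓ = n + 1 := ⟨ℓ - 1, by omega⟩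
      intro v
      by_cases hv : IsMin v
      · rw [heq n (by omega), hmin _ _ hv]
        exact (hau.mul (hself n (by omega) v).ringInverse).mul (hup n (by omega) v).ringInverse
      · exact hnotmin n (by omega) v hv
    refine Rect.reciprocity_of_isUnit (y := fun t v => F t (ExtPoset.ofElem v)) hau hbu
      (fun t ht v => ?_) hup heq (v := (i, j)) (by simp only; omega)
    rcases ht.eq_or_lt with rfl | ht
    · exact hlast v
    · exact hself t ht v
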